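/- **Setting.** There are $K>1$ arms. Arm $j$ has a reward distribution $\xi_j$ supported in $[0,1]$ with mean $\mu_j$, and an impairment distribution on $\{0,1,\dots,d_{\max}\}$, where $d_{\max}\le N$; all impairment distributions have the same mean $\mathbb E[d]$. In round $t$ the variables $R_{t,j}\sim\xi_j$ and $d_{t,j}$ are drawn, independently over rounds. If $J_k$ denotes the arm played in round $k\ge 1$, the reward accrued from playing arm $j$ in round $t$ is $$X_{t,j}=R_{t,j}\,\mathbb I\Big[\sum_{k=\max(t-N,0)}^{t}\mathbb I[J_k=j]\ge d_{t,j}\Big],$$ and the algorithm observes whether the indicator is $1$. **Algorithm (UCB-Revisited+).** Given the horizon $T$ and integers $0=n_0\le n_1\le n_2\le\cdots$, start with phase $m=1$, active set $\mathcal K_1$ equal to the set of all arms, $\tilde\Delta_1=1$ and round $t=1$. While $t\le T$, carry out phase $m$: play each arm $j\in\mathcal K_m$, one arm after the other, for $n_m-n_{m-1}$ consecutive rounds. Let $T_j(m)$ be the set of rounds of phases $1,\dots,m$ in which $j$ was played and the indicator above was $1$, and put $\overline X_{m,j}=\frac1{n_m}\sum_{t\in T_j(m)}X_{t,j}$ for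 $j\in\mathcal K_m$. Obtain $\mathcal K_{m+1}$ from $\mathcal K_m$ by eliminating every $j$ with $\overline X_{m,j}+\tilde\Delta_m/2<\max_{j'\in\mathcal K_m}\overline X_{m,j'}-\tilde\Delta_m/2$; set $\tilde\Delta_{m+1}=\tilde\Delta_m/2$ and pass to phase $m+1$. (A phase that begins in a round $\le T$ is carried to its end.) **Lemma.** Let $T\ge 2$, put $n_0=0$ and, for $m\ge1$, $$n_m=\left\lceil\frac1{\tilde\Delta_m^2}\Big(\sqrt{\log T}+\sqrt{\log T+\tfrac43\tilde\Delta_m\log T+2\tilde\Delta_m z_m}\Big)^2\right\rceil,\qquad z_m=\sqrt{\tfrac49\log^2T+4m\,\mathbb E[d]\log T}.$$ Then $(n_m)_{m\ge0}$ is nondecreasing, and for every $m\ge1$ $$0<n_m\le 1+\frac{4\log T}{\tilde\Delta_m^2}+\frac{16\log T}{3\tilde\Delta_m}+\frac{8\sqrt{m\,\mathbb E[d]\log T}}{\tilde\Delta_m}.$$ Moreover, when UCB-Revisited+ is run with these parameters, for every phase $m\ge1$ and every arm $j$, with probability at least $1-\frac2{T^2}$ the following holds: if phase $m$ is executed and $j\in\mathcal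 K_m$, then $$\overline X_{m,j}-\mu_j\le\tilde\Delta_m/2 .$$ -/

import Mathlib

open MeasureTheory ProbabilityTheory

namespace ImpairedBandit

/-- An instance of the stochastic bandit with impairment, with arms `Fin K`.

* `rewardLaw j` is the reward distribution of arm `j`, carried by `[0,1]`;
* `impairLaw j` is the distribution of the impairment of arm `j`, carried by
  `{0, 1, ..., dmax}` where `dmax ≤ N`;
* all impairment distributions have the same mean `meanImpair`. -/
structure Instance (K : ℕ) where
  N : ℕ
  dmax : ℕ
  dmax_le : dmax ≤ N
  rewardLaw : Fin K → Measure ℝ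
  rewardLaw_prob : ∀ j, IsProbabilityMeasure (rewardLaw j)
  rewardLaw_supp : ∀ j, ∀ᵐ x ∂(rewardLaw j), x ∈ Set.Icc (0 : ℝ) 1
  impairLaw : Fin K → Measure ℕ
  impairLaw_prob : ∀ j, IsProbabilityMeasure (impairLaw j)
  impairLaw_supp : ∀ j, ∀ᵐ x ∂(impairLaw j), x ≤ dmax
  meanImpair : ℝ
  impairLaw_mean : ∀ j, ∫ x, (x : ℝ) ∂(impairLaw j) = meanImpair

/-- The mean reward of arm `j`. -/
noncomputable def Instance.meanReward {K : ℕ} (B : Instance K) (j : Fin K) : ℝ :=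
  ∫ x, x ∂(B.rewardLaw j)

/-- `R t j` and `d t j` (the reward that arm `j` would generate in round `t`, and its impairment
in round `t`) are random variables with the laws prescribed by the instance, and what is drawn in
different rounds is independent.  Within one round no independence is required. -/
structure IsEnvironment {K : ℕ} (B : Instance K) {Ω : Type*} [MeasurableSpace Ω] (P : Measure Ω)
    (R : ℕ → Fin K → Ω → ℝ) (d : ℕ → Fin K → Ω → ℕ) : Prop where
  measurable_reward : ∀ t j, Measurable (R t j)
  measurable_impair : ∀ t j, Measurable (d t j)
  law_reward : ∀ t j, P.map (R t j) = B.rewardLaw j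
  law_impair : ∀ t j, P.map (d t j) = B.impairLaw j
  indep : iIndepFun (fun (t : ℕ) (ω : Ω) (j : Fin K) => (R t j ω, d t j ω)) P

/-- The threshold `Δ̃ₘ` of phase `m ≥ 1`: `Δ̃₁ = 1` and `Δ̃ₘ₊₁ = Δ̃ₘ / 2`. -/
noncomputable def threshold (m : ℕ) : ℝ := (1 / 2 : ℝ) ^ (m - 1)

/-- The quantity `z = √(4 log² T / 9 + 4 m E[d] log T)`. -/
noncomputable def zTerm (T : ℕ) (Ed : ℝ) (m : ℕ) : ℝ :=
  √(4 * Real.log T ^ 2 / 9 + 4 * m * Ed * Real.log T)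

/-- The explicit parameters `nₘ`, a function of the horizon `T`, the expected impairment `Ed` and
the phase `m` only: `n₀ = 0` and, for `m ≥ 1`,
`nₘ = ⌈(√(log T) + √(log T + 4 Δ̃ₘ log T / 3 + 2 Δ̃ₘ z))² / Δ̃ₘ²⌉`. -/
noncomputable def phaseLength (T : ℕ) (Ed : ℝ) (m : ℕ) : ℕ :=
  if m = 0 then 0 else
    ⌈1 / threshold m ^ 2 *
      (√(Real.log T) +
        √(Real.log T + 4 * threshold m * Real.log T / 3 + 2 * threshold m * zTerm T Ed m)) ^ 2⌉₊

/-! The algorithm, run on fixed tables `r t j` of rewards and `δ t j` of impairments.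
Rounds are numbered from `1`.  `J t = some j` means that arm `j` is played in round `t`;
`J t = none` that no arm is (round `0`, or a round not reached yet). -/

/-- `∑_{k = max(t - N, 0)}^{t} 𝕀[J k = j]`. -/
def playCount {K : ℕ} (N : ℕ) (J : ℕ → Option (Fin K)) (t : ℕ) (j : Fin K) : ℕ :=
  ((Finset.Icc (t - N) t).filter (fun k => J k = some j)).card

/-- The reward `X_{t,j}` accrued in round `t` on arm `j`:
`r t j` if the impairment constraint is met, and `0` otherwise. -/
noncomputable def accrued {K : ℕ} (N : ℕ) (r : ℕ → Fin K → ℝ) (δ : ℕ → Fin K → ℕ)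
    (J : ℕ → Option (Fin K)) (t : ℕ) (j : Fin K) : ℝ :=
  if δ t j ≤ playCount N J t j then r t j else 0

/-- The rounds before round `s` in which arm `j` is played and its reward is observed. -/
def observedRounds {K : ℕ} (N : ℕ) (δ : ℕ → Fin K → ℕ) (J : ℕ → Option (Fin K)) (s : ℕ)
    (j : Fin K) : Finset ℕ :=
  (Finset.Ico 1 s).filter (fun t => J t = some j ∧ δ t j ≤ playCount N J t j)

/-- What the algorithm has done after some number of phases. -/
structure State (K : ℕ) where
  /-- the arms that are still active -/
  active : Finset (Fin K)
  /-- the first round not played yet -/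
  next : ℕ
  /-- the arms played in the rounds before `next` -/
  played : ℕ → Option (Fin K)

/-- All arms are active and no round has been played. -/
def State.init (K : ℕ) : State K where
  active := Finset.univ
  next := 1
  played := fun _ => none

/-- The rounds of a phase: the arms in the list `L` are played one after the other, each for
`len` consecutive rounds. Returns the next round and the extended record of plays. -/
def playArms {K : ℕ} (L : List (Fin K)) (len : ℕ) (σ : State K) : ℕ × (ℕ → Option (Fin K)) :=
  (σ.next + L.length * len, fun t =>
    if t < σ.next then σ.played t
    else if t < σ.next + L.length * len then L[(t - σ.next) / len]?
    else none)

/-- `(1 / n) ∑_{t} X_{t,j}`, over the rounds `t < s` in which the reward of arm `j` is observed. -/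
noncomputable def sampleMean {K : ℕ} (N : ℕ) (r : ℕ → Fin K → ℝ) (δ : ℕ → Fin K → ℕ) (n : ℕ)
    (s : ℕ) (J : ℕ → Option (Fin K)) (j : Fin K) : ℝ :=
  1 / (n : ℝ) * ∑ t ∈ observedRounds N δ J s j, accrued N r δ J t j

open Classical in
/-- The state after the phases `1, ..., m` of UCB-Revisited+ with parameters `n`.
In phase `m + 1` the active arms are played, in the order `order (m + 1) active`, for
`n (m + 1) - n m` consecutive rounds each; then arm `j` is eliminated if
`X̄ⱼ + Δ̃ / 2 < max_{j'} X̄ⱼ' - Δ̃ / 2`, the maximum being over the active arms. -/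
noncomputable def afterPhase {K : ℕ} (N : ℕ) (n : ℕ → ℕ)
    (order : ℕ → Finset (Fin K) → List (Fin K))
    (r : ℕ → Fin K → ℝ) (δ : ℕ → Fin K → ℕ) : ℕ → State K
  | 0 => State.init K
  | m + 1 =>
    let σ := afterPhase N n order r δ m
    let p := playArms (order (m + 1) σ.active) (n (m + 1) - n m) σ
    let est := sampleMean N r δ (n (m + 1)) p.1 p.2
    { active := σ.active.filter (fun j => ¬ ∃ j' ∈ σ.active,
        est j + threshold (m + 1) / 2 < est j' - threshold (m + 1) / 2)
      next := p.1
      played := p.2 }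

/-- Phase `m ≥ 1` is executed (its first round is at most the horizon `T`) and arm `j` is active
in it, `j ∈ Kₘ`. -/
def IsActive {K : ℕ} (N T : ℕ) (n : ℕ → ℕ) (order : ℕ → Finset (Fin K) → List (Fin K))
    (r : ℕ → Fin K → ℝ) (δ : ℕ → Fin K → ℕ) (m : ℕ) (j : Fin K) : Prop :=
  (afterPhase N n order r δ (m - 1)).next ≤ T ∧
    j ∈ (afterPhase N n order r δ (m - 1)).active

/-- The estimate `X̄_{m,j}` that the algorithm computes at the end of phase `m ≥ 1`. A phase that
starts before the horizon and is longer than the remaining time is carried to its end. -/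
noncomputable def estimate {K : ℕ} (N : ℕ) (n : ℕ → ℕ)
    (order : ℕ → Finset (Fin K) → List (Fin K))
    (r : ℕ → Fin K → ℝ) (δ : ℕ → Fin K → ℕ) (m : ℕ) (j : Fin K) : ℝ :=
  sampleMean N r δ (n m) (afterPhase N n order r δ m).next
    (afterPhase N n order r δ m).played j

end ImpairedBandit

/-! Impairment can only lower an estimate: rewards are almost surely nonnegative, so `n m` times the
estimate of arm `j` is at most the sum of its generated rewards over all rounds of phases `1, ...,
m` in which it is played, observed or not. There are at most `n m` such rounds (`card_played_le`),
so the upper deviation reduces to a Hoeffding bound for adaptively chosen rounds.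

Whether `j` is played in round `t` depends only on earlier rounds (`runState_predictable`), hence is
independent of what round `t` draws. Multiplying normalised exponentials over the played rounds
therefore gives expectation at most `1`, and Markov's inequality yields `exp (-2 n ε²)`
(`measure_adaptive_sum_gt_le`). With `ε = Δ̃ₘ / 2` and `nₘ Δ̃ₘ² ≥ 4 log T` this is at most `1 / T²`.
The impairment terms in `nₘ` only add samples, and the bound needs neither that `j` is active nor
that the phase is executed. -/

namespace ImpairedBandit

/-! ### Elementary estimates for the explicit parameters -/

theorem threshold_pos (m : ℕ) : 0 < threshold m := by
  unfold threshold; positivity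

theorem threshold_antitone : Antitone threshold := fun _ _ h =>
  pow_le_pow_of_le_one (by norm_num) (by norm_num) (Nat.sub_le_sub_right h 1)

theorem zTerm_mono (T : ℕ) {Ed : ℝ} (hE : 0 ≤ Ed) : Monotone (zTerm T Ed) := by
  intro a b h
  have := Real.log_natCast_nonneg T
  unfold zTerm
  gcongr

theorem zTerm_nonneg (T : ℕ) (Ed : ℝ) (m : ℕ) : 0 ≤ zTerm T Ed m := Real.sqrt_nonneg _

theorem zTerm_le (T : ℕ) {Ed : ℝ} (hE : 0 ≤ Ed) (m : ℕ) :
    zTerm T Ed m ≤ 2 * Real.log T / 3 + 2 * √(m * Ed * Real.log T) := by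
  have hT := Real.log_natCast_nonneg T
  have h0 : 0 ≤ m * Ed * Real.log T := by positivity
  refine Real.sqrt_le_iff.2 ⟨by positivity, ?_⟩
  nlinarith [Real.sq_sqrt h0, mul_nonneg hT (Real.sqrt_nonneg (m * Ed * Real.log T))]

theorem phaseLength_of_pos (T : ℕ) (Ed : ℝ) {m : ℕ} (hm : 1 ≤ m) :
    phaseLength T Ed m = ⌈1 / threshold m ^ 2 * (√(Real.log T) +
      √(Real.log T + 4 * threshold m * Real.log T / 3
        + 2 * threshold m * zTerm T Ed m)) ^ 2⌉₊ :=
  if_neg (by omega)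

/-- Once `1 / D` is moved inside the square, every term increases as `D` decreases and `z`
increases. -/
theorem phaseLength_monotone (T : ℕ) {Ed : ℝ} (hE : 0 ≤ Ed) :
    Monotone (phaseLength T Ed) := by
  have key (L D z : ℝ) (hD : 0 < D) : 1 / D ^ 2 * (√L + √(L + 4 * D * L / 3 + 2 * D * z)) ^ 2
      = (√L / D + √(L / D ^ 2 + 4 * L / 3 / D + 2 * z / D)) ^ 2 := by
    have : L / D ^ 2 + 4 * L / 3 / D + 2 * z / D
        = (L + 4 * D * L / 3 + 2 * D * z) / D ^ 2 := by field_simp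
    rw [this, Real.sqrt_div' _ (by positivity), Real.sqrt_sq hD.le, ← add_div, div_pow]
    ring
  intro a b h
  rcases Nat.eq_zero_or_pos a with rfl | ha
  · simp [phaseLength]
  rw [phaseLength_of_pos T Ed ha, phaseLength_of_pos T Ed (ha.trans_le h),
    key _ _ _ (threshold_pos a), key _ _ _ (threshold_pos b)]
  have h1 := threshold_pos b
  have h2 := threshold_antitone h
  have h3 := zTerm_mono T hE h
  have h4 := zTerm_nonneg T Ed a
  have h4' := zTerm_nonneg T Ed b
  have h5 := threshold_pos a
  have hL := Real.log_natCast_nonneg T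
  gcongr

/-- The second root is at least the first, so the square is at least `(2 √(log T))²`. This is the
only lower bound on `nₘ` that the deviation estimate uses. -/
theorem four_log_le_phaseLength (T : ℕ) (Ed : ℝ) {m : ℕ} (hm : 1 ≤ m) :
    4 * Real.log T ≤ phaseLength T Ed m * threshold m ^ 2 := by
  have hT := Real.log_natCast_nonneg T
  have hD := threshold_pos m
  have hz := zTerm_nonneg T Ed m
  rw [← div_le_iff₀ (by positivity), phaseLength_of_pos T Ed hm]
  refine le_trans ?_ (Nat.le_ceil _)
  rw [div_eq_mul_one_div, mul_comm]
  refine mul_le_mul_of_nonneg_left ?_ (by positivity)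
  have h1 : √(Real.log T) ≤ √(Real.log T + 4 * threshold m * Real.log T / 3
      + 2 * threshold m * zTerm T Ed m) := by
    apply Real.sqrt_le_sqrt
    have : 0 ≤ 4 * threshold m * Real.log T / 3 + 2 * threshold m * zTerm T Ed m := by positivity
    linarith
  nlinarith [Real.sq_sqrt hT, Real.sqrt_nonneg (Real.log T)]

theorem phaseLength_pos {T : ℕ} {Ed : ℝ} (hT : 0 < Real.log T) {m : ℕ} (hm : 1 ≤ m) :
    0 < phaseLength T Ed m := by
  have := four_log_le_phaseLength T Ed hm
  by_contra! h
  rw [Nat.le_zero.1 h] at this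
  norm_num at this
  linarith

theorem phaseLength_le (T : ℕ) {Ed : ℝ} (hE : 0 ≤ Ed) {m : ℕ}
    (hm : 1 ≤ m) :
    (phaseLength T Ed m : ℝ) ≤ 1 + 4 * Real.log T / threshold m ^ 2
      + 16 * Real.log T / (3 * threshold m)
      + 8 * √(m * Ed * Real.log T) / threshold m := by
  have hT := Real.log_natCast_nonneg T
  have hD := threshold_pos m
  have hz := zTerm_nonneg T Ed m
  have hz' := zTerm_le T hE m
  rw [phaseLength_of_pos T Ed hm]
  refine (Nat.ceil_lt_add_one (by positivity)).le.trans ?_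
  set D := threshold m
  set L := Real.log T
  set z := zTerm T Ed m
  set s := √(m * Ed * L)
  have hB : 0 ≤ L + 4 * D * L / 3 + 2 * D * z := by positivity
  have h1 : (√L + √(L + 4 * D * L / 3 + 2 * D * z)) ^ 2
      ≤ 4 * L + 16 * L * D / 3 + 8 * s * D := by
    -- From `(a + b)² ≤ 2 (a² + b²)` the square is at most `4L + 8DL/3 + 4Dz`; then `z ≤ 2L/3 + 2s`.
    have := add_sq_le (a := √L) (b := √(L + 4 * D * L / 3 + 2 * D * z))
    rw [Real.sq_sqrt hT, Real.sq_sqrt hB] at this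
    nlinarith [mul_le_mul_of_nonneg_left hz' hD.le]
  calc _ ≤ 1 / D ^ 2 * (4 * L + 16 * L * D / 3 + 8 * s * D) + 1 := by gcongr
    _ = _ := by field_simp; ring

open scoped ENNReal

/-! ### Concentration under predictable sampling -/

section Adaptive

variable {Ω S : Type*} [MeasurableSpace Ω] [MeasurableSpace S] {P : Measure Ω} {W : ℕ → Ω → S}

/-- A function of the past is independent of a function of the present. -/
theorem indepFun_of_dependsOn_Iio [Nonempty Ω] {β γ : Type*} [MeasurableSpace β] [MeasurableSpace γ]
    (hW : ∀ t, Measurable (W t)) (hind : iIndepFun W P) (s : ℕ)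
    {g : (ℕ → S) → β} (hg : Measurable g) (hdep : DependsOn g (Set.Iio s))
    {f : S → γ} (hf : Measurable f) :
    IndepFun (fun ω => g (fun t => W t ω)) (fun ω => f (W s ω)) P := by
  let ω₀ := Classical.arbitrary Ω
  have h := hind.indepFun_finset (Finset.range s) {s} (by simp) hW
  -- Freezing the coordinates from `s` on at the values of one outcome makes `g` a function of
  -- finitely many coordinates.
  let g' : (Finset.range s → S) → β := fun u =>
    g (fun t => if h : t ∈ Finset.range s then u ⟨t, h⟩ else W t ω₀)
  have hg' : Measurable g' := by
    refine hg.comp (measurable_pi_lambda _ fun t => ?_)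
    by_cases ht : t ∈ Finset.range s
    · simpa only [ht, dif_pos] using measurable_pi_apply _
    · simp only [ht, dif_neg, not_false_eq_true, measurable_const]
  have hf' : Measurable fun u : ({s} : Finset ℕ) → S => f (u ⟨s, by simp⟩) :=
    hf.comp (measurable_pi_apply _)
  have h2 := h.comp hg' hf'
  have : (fun ω => g (fun t => W t ω))
      = g' ∘ fun ω (i : Finset.range s) => W i ω := by
    funext ω
    refine hdep fun t ht => ?_
    simp [show t < s from ht]
  rw [this]
  exact h2

/-- If the decision to multiply by `f (W t)` in round `t` depends only on earlier rounds, and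
`f (W t)` has mean at most `1`, then the product has mean at most `1`. -/
theorem lintegral_prod_adaptive_le_one [IsProbabilityMeasure P]
    (hW : ∀ t, Measurable (W t)) (hind : iIndepFun W P)
    (A : ℕ → (ℕ → S) → Prop) [∀ t x, Decidable (A t x)]
    (hA : ∀ t, MeasurableSet {x | A t x}) (hdep : ∀ t, DependsOn (A t) (Set.Iio t))
    {f : S → ℝ≥0∞} (hf : Measurable f) (hint : ∀ t, ∫⁻ ω, f (W t ω) ∂P ≤ 1) (s : ℕ) :
    ∫⁻ ω, ∏ t ∈ Finset.range s, (if A t (fun t => W t ω) then f (W t ω) else 1) ∂P ≤ 1 := by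
  have : Nonempty Ω := nonempty_of_isProbabilityMeasure P
  have hW' : Measurable fun ω t => W t ω := measurable_pi_lambda _ hW
  let M : ℕ → (ℕ → S) → ℝ≥0∞ := fun s x =>
    ∏ t ∈ Finset.range s, if A t x then f (x t) else 1
  have hM : ∀ s, Measurable (M s) := fun s => Finset.measurable_prod _ fun t _ =>
    Measurable.ite (hA t) (hf.comp (measurable_pi_apply t)) measurable_const
  have hMdep : ∀ s, DependsOn (M s) (Set.Iio s) := fun s x y hxy =>
    Finset.prod_congr rfl fun t ht => by
      have hts := Finset.mem_range.1 ht
      have h1 : A t x = A t y := hdep t fun i hi => hxy i (lt_trans hi hts)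
      simp only [h1, hxy t hts]
  induction s with
  | zero => simp
  | succ s ih =>
    -- The past product is split by whether round `s` is sampled; only `g₁` meets the new factor,
    -- and it is independent of it.
    let g₁ : (ℕ → S) → ℝ≥0∞ := fun x => if A s x then M s x else 0
    let g₂ : (ℕ → S) → ℝ≥0∞ := fun x => if A s x then 0 else M s x
    have hg₁ : Measurable g₁ := Measurable.ite (hA s) (hM s) measurable_const
    have hg₂ : Measurable g₂ := Measurable.ite (hA s) measurable_const (hM s)
    have hg₂' : Measurable fun ω => g₂ fun t => W t ω := hg₂.comp hW'
    have hdep₁ : DependsOn g₁ (Set.Iio s) := fun x y hxy => by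
      simp only [g₁, hdep s hxy, hMdep s hxy]
    have hI := indepFun_of_dependsOn_Iio hW hind s hg₁ hdep₁ hf
    calc ∫⁻ ω, ∏ t ∈ Finset.range (s + 1),
          (if A t (fun t => W t ω) then f (W t ω) else 1) ∂P
        = ∫⁻ ω, ((fun ω => g₁ fun t => W t ω) * fun ω => f (W s ω)) ω
            + g₂ (fun t => W t ω) ∂P := by
          refine lintegral_congr fun ω => ?_
          rw [Finset.prod_range_succ]
          by_cases h : A s (fun t => W t ω) <;> simp [g₁, g₂, M, h]
      _ = (∫⁻ ω, g₁ (fun t => W t ω) ∂P) * (∫⁻ ω, f (W s ω) ∂P)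
            + ∫⁻ ω, g₂ (fun t => W t ω) ∂P := by
          rw [lintegral_add_right _ hg₂',
            lintegral_mul_eq_lintegral_mul_lintegral_of_indepFun (f := fun ω => g₁ fun t => W t ω)
              (g := fun ω => f (W s ω)) (hg₁.comp hW') (hf.comp (hW s)) hI]
      _ ≤ (∫⁻ ω, g₁ (fun t => W t ω) ∂P) + ∫⁻ ω, g₂ (fun t => W t ω) ∂P := by
          gcongr
          exact mul_le_of_le_one_right' (hint s)
      _ = ∫⁻ ω, M s (fun t => W t ω) ∂P := by
          rw [← lintegral_add_right _ hg₂']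
          refine lintegral_congr fun ω => ?_
          by_cases h : A s (fun t => W t ω) <;> simp [g₁, g₂, h]
      _ ≤ 1 := ih

/-- A one-sided Hoeffding inequality for adaptively sampled bounded variables: if round `t` is
sampled according to a rule that depends only on earlier rounds, then, except with probability
`exp (-2 n ε²)`, whenever at most `n` rounds are sampled the centred sum is at most `n ε`. -/
theorem measure_adaptive_sum_gt_le [IsProbabilityMeasure P]
    (hW : ∀ t, Measurable (W t)) (hind : iIndepFun W P)
    (A : ℕ → (ℕ → S) → Prop) [∀ t x, Decidable (A t x)]
    (hA : ∀ t, MeasurableSet {x | A t x}) (hdep : ∀ t, DependsOn (A t) (Set.Iio t))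
    {φ : S → ℝ} (hφ : Measurable φ) {μ : ℝ} (hmem : ∀ t, ∀ᵐ ω ∂P, φ (W t ω) ∈ Set.Icc (0 : ℝ) 1)
    (hmean : ∀ t, ∫ ω, φ (W t ω) ∂P = μ) (s n : ℕ) {ε : ℝ} (hε : 0 ≤ ε) :
    P.real {ω | ((Finset.range s).filter fun t => A t fun t => W t ω).card ≤ n ∧
        n * ε < ∑ t ∈ (Finset.range s).filter fun t => A t fun t => W t ω, (φ (W t ω) - μ)}
      ≤ Real.exp (-2 * n * ε ^ 2) := by
  -- A variable in `[0,1]` is sub-Gaussian with variance proxy `1/4`, so its centred mgf at `4ε` is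
  -- at most `exp (2ε²)`. The choice `4ε` maximises `λ n ε - n λ² / 8`.
  let f : S → ℝ≥0∞ := fun p => ENNReal.ofReal (Real.exp (4 * ε * (φ p - μ) - 2 * ε ^ 2))
  have hf : Measurable f := by fun_prop
  have hint : ∀ t, ∫⁻ ω, f (W t ω) ∂P ≤ 1 := by
    intro t
    have hsub := hasSubgaussianMGF_of_mem_Icc (hφ.comp (hW t)).aemeasurable (hmem t)
    simp only [Function.comp_apply, hmean t] at hsub
    have hi := (hsub.integrable_exp_mul (4 * ε)).mul_const (Real.exp (-(2 * ε ^ 2)))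
    have hm := hsub.mgf_le (4 * ε)
    have hfe : ∀ ω, Real.exp (4 * ε * (φ (W t ω) - μ) - 2 * ε ^ 2)
        = Real.exp (4 * ε * (φ (W t ω) - μ)) * Real.exp (-(2 * ε ^ 2)) := fun ω => by
      rw [← Real.exp_add, sub_eq_add_neg]
    simp only [f, hfe]
    rw [← ofReal_integral_eq_lintegral_ofReal hi (ae_of_all _ fun ω => by positivity),
      integral_mul_const]
    refine ENNReal.ofReal_le_one.2 ?_
    calc _ ≤ Real.exp (2 * ε ^ 2) * Real.exp (-(2 * ε ^ 2)) := by
          gcongr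
          refine hm.trans_eq ?_
          congr 1
          norm_num
          ring
      _ = 1 := by rw [← Real.exp_add]; simp
  have hprod := lintegral_prod_adaptive_le_one hW hind A hA hdep hf hint s
  have hmeas : Measurable fun ω =>
      ∏ t ∈ Finset.range s, (if A t (fun t => W t ω) then f (W t ω) else 1) :=
    Finset.measurable_prod _ fun t _ =>
      Measurable.ite (measurable_pi_lambda _ hW (hA t)) (hf.comp (hW t)) measurable_const
  have hmarkov := meas_ge_le_lintegral_div (μ := P) hmeas.aemeasurable
    (ε := ENNReal.ofReal (Real.exp (2 * n * ε ^ 2))) (by simp [Real.exp_pos]) (by simp)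
  refine ENNReal.toReal_le_of_le_ofReal (Real.exp_pos _).le ?_
  refine le_trans (measure_mono ?_) (hmarkov.trans ?_)
  · rintro ω ⟨hc, hs⟩
    simp only [Set.mem_ofPred_eq]
    rw [← Finset.prod_filter]
    simp only [f]
    rw [← ENNReal.ofReal_prod_of_nonneg fun _ _ => (Real.exp_pos _).le, ← Real.exp_sum]
    refine ENNReal.ofReal_le_ofReal (Real.exp_le_exp.2 ?_)
    rw [Finset.sum_sub_distrib, ← Finset.mul_sum, Finset.sum_const, nsmul_eq_mul]
    have hc' : ((((Finset.range s).filter fun t => A t fun t => W t ω).card : ℕ) : ℝ) ≤ n := by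
      exact_mod_cast hc
    -- On the event the exponent is at least `4ε · nε - 2nε² = 2nε²`; sampling fewer than `n` rounds
    -- only reduces the subtracted term.
    nlinarith [mul_le_mul_of_nonneg_left hs.le hε, mul_le_mul_of_nonneg_right hc' (sq_nonneg ε)]
  · refine (ENNReal.div_le_div_right hprod _).trans_eq ?_
    rw [one_div, ← ENNReal.ofReal_inv_of_pos (Real.exp_pos _), ← Real.exp_neg]
    congr 2
    ring

end Adaptive

/-! ### Counting, predictability and measurability of the plays -/

section Run

variable {K : ℕ}

/-- Without repetitions `j` occupies at most one index `i`, hence only the block of `len` rounds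
starting at `a + i * len`. -/
theorem card_phase_le {L : List (Fin K)} (hL : L.Nodup) (len a : ℕ) (j : Fin K) :
    ((Finset.Ico a (a + L.length * len)).filter fun t => L[(t - a) / len]? = some j).card
      ≤ len := by
  rcases Nat.eq_zero_or_pos len with rfl | hlen
  · simp
  by_cases h : ∃ i : ℕ, L[i]? = some j
  · obtain ⟨i, hi⟩ := h
    have hil : i < L.length := by
      by_contra! h'
      simp [List.getElem?_eq_none h'] at hi
    calc _ ≤ (Finset.Ico (a + i * len) (a + i * len + len)).card := by
          refine Finset.card_le_card fun t ht => ?_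
          simp only [Finset.mem_filter, Finset.mem_Ico] at ht ⊢
          have h1 : i = (t - a) / len := (List.getElem?_inj hil hL).1 (hi.trans ht.2.symm)
          have h2 := Nat.div_mul_le_self (t - a) len
          have h3 := Nat.lt_div_mul_add (a := t - a) hlen
          rw [← h1] at h2 h3
          omega
      _ = len := by simp
  · rw [Finset.card_eq_zero.2]
    · exact Nat.zero_le _
    · exact Finset.filter_eq_empty_iff.2 fun t _ ht => h ⟨_, ht⟩

variable (N : ℕ) (n : ℕ → ℕ) (order : ℕ → Finset (Fin K) → List (Fin K))

/-- In phases `1, ..., m`, an arm is played in at most `n m` rounds. -/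
theorem card_played_le (hn : Monotone n) (horder : ∀ m S, (order m S).Nodup)
    (r : ℕ → Fin K → ℝ) (δ : ℕ → Fin K → ℕ) (j : Fin K) (s m : ℕ) :
    ((Finset.range s).filter fun t => (afterPhase N n order r δ m).played t = some j).card
      ≤ n m := by
  induction m with
  | zero => simp [afterPhase, State.init]
  | succ m ih =>
    set σ := afterPhase N n order r δ m with hσ
    have hlen := Nat.sub_add_cancel (hn (Nat.le_succ m))
    rw [add_comm] at hlen
    refine le_trans ?_ ((add_le_add ih (card_phase_le (horder (m + 1) σ.active)
      (n (m + 1) - n m) σ.next j)).trans_eq hlen)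
    refine le_trans (Finset.card_le_card fun t ht => ?_) (Finset.card_union_le _ _)
    rw [Finset.mem_filter] at ht
    obtain ⟨ht1, ht2⟩ := ht
    rw [Finset.mem_union, Finset.mem_filter, Finset.mem_filter, Finset.mem_Ico]
    simp only [afterPhase, playArms, ← hσ] at ht2
    split_ifs at ht2 with h1 h2
    · exact Or.inl ⟨ht1, ht2⟩
    · exact Or.inr ⟨⟨not_lt.1 h1, h2⟩, ht2⟩

/-- The state of the algorithm, run on a joint table of rewards and impairments. -/
noncomputable def runState (m : ℕ) (x : ℕ → Fin K → ℝ × ℕ) : State K :=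
  afterPhase N n order (fun t i => (x t i).1) (fun t i => (x t i).2) m

/-- The estimate that is computed from the plays `J` in the rounds before `s`. -/
noncomputable def tableMean (n s : ℕ) (J : ℕ → Option (Fin K)) (x : ℕ → Fin K → ℝ × ℕ)
    (j : Fin K) : ℝ :=
  sampleMean N (fun t i => (x t i).1) (fun t i => (x t i).2) n s J j

open Classical in
/-- The arms that survive phase `m`, if the plays are `J` and the phase ends before round `s`. -/
noncomputable def survivors (n m s : ℕ) (J : ℕ → Option (Fin K)) (S : Finset (Fin K))
    (x : ℕ → Fin K → ℝ × ℕ) : Finset (Fin K) :=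
  S.filter fun j => ¬ ∃ j' ∈ S,
    tableMean N n s J x j + threshold m / 2 < tableMean N n s J x j' - threshold m / 2

/-- The effect of phase `m + 1` on the state. -/
noncomputable def runPhase (m : ℕ) (σ : State K) (x : ℕ → Fin K → ℝ × ℕ) : State K :=
  let p := playArms (order (m + 1) σ.active) (n (m + 1) - n m) σ
  ⟨survivors N (n (m + 1)) (m + 1) p.1 p.2 σ.active x, p.1, p.2⟩

theorem runState_succ (m : ℕ) (x : ℕ → Fin K → ℝ × ℕ) :
    runState N n order (m + 1) x = runPhase N n order m (runState N n order m x) x := rfl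

theorem tableMean_eq (n s : ℕ) (J : ℕ → Option (Fin K)) (x : ℕ → Fin K → ℝ × ℕ) (j : Fin K) :
    tableMean N n s J x j = 1 / (n : ℝ) * ∑ t ∈ Finset.Ico 1 s,
      if J t = some j ∧ (x t j).2 ≤ playCount N J t j then (x t j).1 else 0 := by
  rw [tableMean, sampleMean, observedRounds, Finset.sum_filter]
  congr 1
  refine Finset.sum_congr rfl fun t _ => ?_
  by_cases h : (x t j).2 ≤ playCount N J t j <;> simp [accrued, h]

theorem dependsOn_tableMean (n s : ℕ) (J : ℕ → Option (Fin K)) (j : Fin K) :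
    DependsOn (fun x => tableMean N n s J x j) (Set.Iio s) := fun x y hxy => by
  simp only [tableMean_eq]
  congr 1
  refine Finset.sum_congr rfl fun t ht => ?_
  rw [hxy t (Finset.mem_Ico.1 ht).2]

theorem measurable_tableMean (n s : ℕ) (J : ℕ → Option (Fin K)) (j : Fin K) :
    Measurable fun x => tableMean N n s J x j := by
  simp only [tableMean_eq]
  refine (Finset.measurable_sum _ fun t _ => Measurable.ite ?_ (by fun_prop)
    measurable_const).const_mul _
  have h2 : Measurable fun x : ℕ → Fin K → ℝ × ℕ => (x t j).2 := by fun_prop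
  exact (MeasurableSet.const (J t = some j)).inter
    (measurableSet_le h2 (measurable_const (a := playCount N J t j)))

theorem dependsOn_survivors (n m s : ℕ) (J : ℕ → Option (Fin K)) (S : Finset (Fin K)) :
    DependsOn (survivors N n m s J S) (Set.Iio s) := fun x y hxy => by
  have h (j : Fin K) : tableMean N n s J x j = tableMean N n s J y j :=
    dependsOn_tableMean N n s J j hxy
  simp only [survivors, h]

theorem measurableSet_survivors_eq (n m s : ℕ) (J : ℕ → Option (Fin K)) (S S' : Finset (Fin K)) :
    MeasurableSet {x | survivors N n m s J S x = S'} := by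
  have h : {x | survivors N n m s J S x = S'} = ⋂ j, {x | (j ∈ S ∧ ¬ ∃ j' ∈ S,
      tableMean N n s J x j + threshold m / 2 < tableMean N n s J x j' - threshold m / 2)
        ↔ j ∈ S'} := by
    ext x
    simp [survivors, Finset.ext_iff]
  have h' (j : Fin K) : MeasurableSet {x | ∃ j' ∈ S, tableMean N n s J x j + threshold m / 2
      < tableMean N n s J x j' - threshold m / 2} := by
    have : {x | ∃ j' ∈ S, tableMean N n s J x j + threshold m / 2
        < tableMean N n s J x j' - threshold m / 2} = ⋃ j' ∈ S, {x | tableMean N n s J x j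
          + threshold m / 2 < tableMean N n s J x j' - threshold m / 2} := by
      ext x; simp
    rw [this]
    exact Finset.measurableSet_biUnion _ fun j' _ => measurableSet_lt
      ((measurable_tableMean N n s J j).add_const _)
      ((measurable_tableMean N n s J j').sub_const _)
  rw [h]
  exact MeasurableSet.iInter fun j =>
    MeasurableSet.iff (MeasurableSet.inter (.const (j ∈ S)) (h' j).compl) (.const (j ∈ S'))

/-- The state is determined by the rounds before the first round not played yet, and the arm
played in round `t` by the rounds before `t`. -/
theorem runState_predictable (m s : ℕ) : ∀ x y : ℕ → Fin K → ℝ × ℕ,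
    (∀ i < s, x i = y i) →
    ((runState N n order m x).next ≤ s → runState N n order m x = runState N n order m y) ∧
    ∀ t ≤ s, (runState N n order m x).played t = (runState N n order m y).played t := by
  induction m with
  | zero => exact fun x y _ => ⟨fun _ => rfl, fun _ _ => rfl⟩
  | succ m ih =>
    intro x y hxy
    -- If phase `m + 1` starts by round `s`, its starting state is common to both tables and fixes
    -- its whole schedule. Otherwise it starts after `s` in both runs and leaves the plays up to `s`
    -- unchanged.
    by_cases h : (runState N n order m x).next ≤ s
    · have hσ := (ih x y hxy).1 h
      rw [runState_succ, runState_succ, ← hσ]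
      refine ⟨fun h' => ?_, fun _ _ => rfl⟩
      simp only [runPhase, State.mk.injEq, and_true]
      exact dependsOn_survivors _ _ _ _ _ _ fun i hi => hxy i (lt_of_lt_of_le hi h')
    · have h' : ¬ (runState N n order m y).next ≤ s := fun h' =>
        h ((ih y x fun i hi => (hxy i hi).symm).1 h' ▸ h')
      rw [not_le] at h h'
      refine ⟨fun h2 => absurd ((Nat.le_add_right _ _).trans h2) (not_le.2 h), fun t ht => ?_⟩
      simp only [runState_succ, runPhase, playArms, ht.trans_lt h, ht.trans_lt h', if_true]
      exact (ih x y hxy).2 t ht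

/-- Given the previous state, the table influences the next one only through the surviving set, one
of finitely many. This bounds the random phase ends and lets measurability be checked state by
state. -/
theorem finite_range_runState (m : ℕ) : (Set.range (runState N n order m)).Finite := by
  induction m with
  | zero => exact (Set.finite_singleton (State.init K)).subset (by rintro _ ⟨x, rfl⟩; rfl)
  | succ m ih =>
    refine (ih.image2 (fun σ S => (⟨S, (playArms (order (m + 1) σ.active)
      (n (m + 1) - n m) σ).1, (playArms (order (m + 1) σ.active)
      (n (m + 1) - n m) σ).2⟩ : State K)) (Set.toFinite Set.univ)).subset ?_
    rintro _ ⟨x, rfl⟩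
    exact ⟨_, ⟨x, rfl⟩, _, Set.mem_univ _, rfl⟩

theorem measurableSet_runState_mem (m : ℕ) :
    ∀ Q : Set (State K), MeasurableSet {x | runState N n order m x ∈ Q} := by
  induction m with
  | zero => exact fun Q => .const (State.init K ∈ Q)
  | succ m ih =>
    intro Q
    have h : {x | runState N n order (m + 1) x ∈ Q} =
        ⋃ σ ∈ Set.range (runState N n order m), ⋃ S' : Finset (Fin K),
          {x | runState N n order m x ∈ ({σ} : Set (State K))} ∩
          ({x | survivors N (n (m + 1)) (m + 1)
            (playArms (order (m + 1) σ.active) (n (m + 1) - n m) σ).1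
            (playArms (order (m + 1) σ.active) (n (m + 1) - n m) σ).2 σ.active x = S'} ∩
          {_x | (⟨S', (playArms (order (m + 1) σ.active) (n (m + 1) - n m) σ).1,
            (playArms (order (m + 1) σ.active) (n (m + 1) - n m) σ).2⟩ : State K) ∈ Q}) := by
      ext x
      simp only [Set.mem_iUnion, Set.mem_inter_iff, Set.mem_ofPred_eq, Set.mem_singleton_iff,
        runState_succ]
      constructor
      · exact fun hx => ⟨_, ⟨x, rfl⟩, _, rfl, rfl, hx⟩
      · rintro ⟨σ, _, S', rfl, rfl, hQ⟩
        exact hQ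
    rw [h]
    refine (finite_range_runState N n order m).measurableSet_biUnion fun σ _ =>
      MeasurableSet.iUnion fun S' => (ih {σ}).inter
        ((measurableSet_survivors_eq _ _ _ _ _ _ _).inter (.const _))

end Run

theorem Instance.meanImpair_nonneg {K : ℕ} (B : Instance K) (j : Fin K) : 0 ≤ B.meanImpair := by
  rw [← B.impairLaw_mean j]
  exact integral_nonneg fun x => Nat.cast_nonneg x

/-! ### Deviation of the estimates in the random environment -/

section Environment

variable {K : ℕ} {B : Instance K} {Ω : Type*} [MeasurableSpace Ω] {P : Measure Ω}
  {R : ℕ → Fin K → Ω → ℝ} {d : ℕ → Fin K → Ω → ℕ}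

theorem IsEnvironment.ae_reward_mem (h : IsEnvironment B P R d) (t : ℕ) (j : Fin K) :
    ∀ᵐ ω ∂P, R t j ω ∈ Set.Icc (0 : ℝ) 1 := by
  have := B.rewardLaw_supp j
  rw [← h.law_reward t j] at this
  exact ae_of_ae_map (h.measurable_reward t j).aemeasurable this

theorem IsEnvironment.integral_reward (h : IsEnvironment B P R d) (t : ℕ) (j : Fin K) :
    ∫ ω, R t j ω ∂P = B.meanReward j := by
  rw [Instance.meanReward, ← h.law_reward t j,
    integral_map (f := fun x => x) (h.measurable_reward t j).aemeasurable
      aestronglyMeasurable_id]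

theorem Instance.meanReward_nonneg (B : Instance K) (j : Fin K) : 0 ≤ B.meanReward j :=
  integral_nonneg_of_ae ((B.rewardLaw_supp j).mono fun _ hx => hx.1)

/-- The estimates of UCB-Revisited+ exceed the mean rewards by more than `ε` with probability at
most `exp (-2 n ε²)`. -/
theorem IsEnvironment.measure_estimate_gt_le [IsProbabilityMeasure P] (h : IsEnvironment B P R d)
    (N : ℕ) {n : ℕ → ℕ} (hn : Monotone n) {order : ℕ → Finset (Fin K) → List (Fin K)}
    (horder : ∀ m S, (order m S).Nodup) {m : ℕ} (hm : 0 < n m) (j : Fin K) {ε : ℝ} (hε : 0 ≤ ε) :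
    P.real {ω | ε < estimate N n order (fun t i => R t i ω) (fun t i => d t i ω) m j
        - B.meanReward j} ≤ Real.exp (-2 * n m * ε ^ 2) := by
  let W : ℕ → Ω → Fin K → ℝ × ℕ := fun t ω i => (R t i ω, d t i ω)
  let A : ℕ → (ℕ → Fin K → ℝ × ℕ) → Prop := fun t x =>
    (runState N n order m x).played t = some j
  have hW : ∀ t, Measurable (W t) := fun t => measurable_pi_lambda _ fun i =>
    (h.measurable_reward t i).prodMk (h.measurable_impair t i)
  have hA : ∀ t, MeasurableSet {x | A t x} := fun t =>
    measurableSet_runState_mem N n order m {σ | σ.played t = some j}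
  have hdep : ∀ t, DependsOn (A t) (Set.Iio t) := fun t x y hxy => by
    simp only [A, (runState_predictable N n order m t x y hxy).2 t le_rfl]
  -- A deterministic bound on the end of phase `m` replaces the random index range by a fixed one.
  obtain ⟨s, hs⟩ : ∃ s, ∀ ω, (runState N n order m fun t => W t ω).next ≤ s := by
    obtain ⟨s, hs⟩ := ((finite_range_runState N n order m).image State.next).bddAbove
    exact ⟨s, fun ω => hs ⟨_, ⟨_, rfl⟩, rfl⟩⟩
  have hmain := measure_adaptive_sum_gt_le hW h.indep A hA hdep
    (φ := fun p : Fin K → ℝ × ℕ => (p j).1) (by fun_prop) (h.ae_reward_mem · j)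
    (h.integral_reward · j) s (n m) hε
  refine le_trans ?_ hmain
  refine ENNReal.toReal_mono (measure_ne_top _ _) (measure_mono_ae ?_)
  filter_upwards [ae_all_iff.2 fun t => h.ae_reward_mem t j] with ω hω hlt
  have hc : ((Finset.range s).filter fun t => A t fun t => W t ω).card ≤ n m :=
    card_played_le N n order hn horder _ _ j s m
  refine ⟨hc, ?_⟩
  have hlt' : ε < tableMean N (n m) (runState N n order m fun t => W t ω).next
    (runState N n order m fun t => W t ω).played (fun t => W t ω) j - B.meanReward j := hlt
  have hnm : (0 : ℝ) < n m := Nat.cast_pos.2 hm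
  have hle : ∑ t ∈ Finset.Ico 1 (runState N n order m fun t => W t ω).next,
      (if (runState N n order m fun t => W t ω).played t = some j ∧ (W t ω j).2 ≤
        playCount N (runState N n order m fun t => W t ω).played t j then (W t ω j).1 else 0)
      ≤ ∑ t ∈ (Finset.range s).filter fun t => A t fun t => W t ω, (W t ω j).1 := by
    rw [← Finset.sum_filter]
    refine Finset.sum_le_sum_of_subset_of_nonneg (fun t ht => ?_) fun t _ _ => (hω t).1
    rw [Finset.mem_filter, Finset.mem_Ico] at ht
    exact Finset.mem_filter.2 ⟨Finset.mem_range.2 (ht.1.2.trans_le (hs ω)), ht.2.1⟩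
  rw [tableMean_eq, lt_sub_iff_add_lt, one_div, inv_mul_eq_div, lt_div_iff₀ hnm] at hlt'
  rw [Finset.sum_sub_distrib, Finset.sum_const, nsmul_eq_mul]
  have hc' : ((((Finset.range s).filter fun t => A t fun t => W t ω).card : ℕ) : ℝ) ≤ n m := by
    exact_mod_cast hc
  -- The arm may have been played fewer than `n m` times; since its mean is nonnegative, subtracting
  -- `n m` means is the stronger centring.
  have := mul_le_mul_of_nonneg_right hc' (B.meanReward_nonneg j)
  linarith

end Environment

end ImpairedBandit

/-! ### The lemma for UCB-Revisited+ -/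

theorem mainTheorem6 {K : ℕ} (hK : 1 < K) (T : ℕ) (hT : 2 ≤ T)
    (B : ImpairedBandit.Instance K)
    (order : ℕ → Finset (Fin K) → List (Fin K))
    (horder : ∀ m S, (order m S).Nodup ∧ ∀ j, j ∈ order m S ↔ j ∈ S)
    {Ω : Type*} [MeasurableSpace Ω] (P : Measure Ω) [IsProbabilityMeasure P]
    (R : ℕ → Fin K → Ω → ℝ) (d : ℕ → Fin K → Ω → ℕ)
    (henv : ImpairedBandit.IsEnvironment B P R d) :
    Monotone (ImpairedBandit.phaseLength T B.meanImpair) ∧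
    ∀ m : ℕ, 1 ≤ m →
      0 < ImpairedBandit.phaseLength T B.meanImpair m ∧
      (ImpairedBandit.phaseLength T B.meanImpair m : ℝ) ≤
        1 + 4 * Real.log T / ImpairedBandit.threshold m ^ 2
          + 16 * Real.log T / (3 * ImpairedBandit.threshold m)
          + 8 * √(m * B.meanImpair * Real.log T) / ImpairedBandit.threshold m ∧
      ∀ j : Fin K,
        1 - 2 / (T : ℝ) ^ 2 ≤
          P.real {ω |
            ImpairedBandit.IsActive B.N T (ImpairedBandit.phaseLength T B.meanImpair) order
              (fun t i => R t i ω) (fun t i => d t i ω) m j →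
            ImpairedBandit.estimate B.N (ImpairedBandit.phaseLength T B.meanImpair) order
              (fun t i => R t i ω) (fun t i => d t i ω) m j - B.meanReward j
              ≤ ImpairedBandit.threshold m / 2} := by
  have hE := B.meanImpair_nonneg ⟨0, by omega⟩
  have hlog : 0 < Real.log T := Real.log_pos (by exact_mod_cast hT)
  have hT0 : (0 : ℝ) < T := by positivity
  have hmono := ImpairedBandit.phaseLength_monotone T hE
  refine ⟨hmono, fun m hm => ?_⟩
  have hpos := ImpairedBandit.phaseLength_pos (Ed := B.meanImpair) hlog hm
  refine ⟨hpos, ImpairedBandit.phaseLength_le T hE hm, fun j => ?_⟩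
  have hdev := henv.measure_estimate_gt_le B.N hmono (fun m S => (horder m S).1) hpos j
    (half_pos (ImpairedBandit.threshold_pos m)).le
  have hlarge := ImpairedBandit.four_log_le_phaseLength T B.meanImpair hm
  have hexp : Real.exp (-2 * ImpairedBandit.phaseLength T B.meanImpair m
      * (ImpairedBandit.threshold m / 2) ^ 2) ≤ 2 / (T : ℝ) ^ 2 := by
    calc _ ≤ Real.exp (-(2 * Real.log T)) := Real.exp_le_exp.2 (by linarith)
      _ = 1 / (T : ℝ) ^ 2 := by
        rw [Real.exp_neg, two_mul, Real.exp_add, Real.exp_log hT0, one_div, sq]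
      _ ≤ _ := by gcongr; norm_num
  set E := {ω | ImpairedBandit.IsActive B.N T (ImpairedBandit.phaseLength T B.meanImpair) order
    (fun t i => R t i ω) (fun t i => d t i ω) m j →
      ImpairedBandit.estimate B.N (ImpairedBandit.phaseLength T B.meanImpair) order
        (fun t i => R t i ω) (fun t i => d t i ω) m j - B.meanReward j
        ≤ ImpairedBandit.threshold m / 2} with hEdef
  -- Subadditivity `1 ≤ P E + P Eᶜ` suffices, so measurability of `E` is never needed.
  have hcompl := measureReal_mono (μ := P) (s₁ := Eᶜ) (s₂ := {ω | ImpairedBandit.threshold m / 2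
    < ImpairedBandit.estimate B.N (ImpairedBandit.phaseLength T B.meanImpair) order
      (fun t i => R t i ω) (fun t i => d t i ω) m j - B.meanReward j}) (fun ω hω => by
    simp only [hEdef, Set.mem_compl_iff, Set.mem_ofPred_eq, Classical.not_imp, not_le] at hω
    exact hω.2)
  have hunion := measureReal_union_le (μ := P) E Eᶜ
  rw [Set.union_compl_self, probReal_univ] at hunion
  linarith
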